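/- Setting. Fix $n\ge 1$, a finite non-empty set $\mathcal S$ and a noise space $\mathcal W$. For $s=(s^1,\dots,s^n)\in\mathcal S^n$ let $\mathrm{emp}(s)(a)=\frac1n\sum_{i=1}^n\mathbf 1\{s^i=a\}$, and let $\mathcal M(n)$ be the set of vectors $(\alpha_a)_{a\in\mathcal S}$ with entries in $\{0,\frac1n,\dots,1\}$ and sum $1$. Node states evolve by $s^i_{t+1}=f(s^i_t,m_t,w^i_t)$, $t\in\mathbb N=\{1,2,\dots\}$, where $m_t=\mathrm{emp}(s_t)$ is the data. A decision maker chooses $a_t=g_t(o_{1:t},a_{1:t-1})\in\{0,1\}$. It observes $o_1=m_1$, and $o_{t+1}=m_{t+1}$ if $a_t=1$ and the data are credible ($\eta_t=1$), $o_{t+1}=\mathtt{blank}$ otherwise. The variables $s_1,w_1,w_2,\dots,\eta_1,\eta_2,\dots$ are mutually independent, each $w_t=(w^1_t,\dots,w^n_t)$ has the law $P_{\mathbf w}$, and $\mathbb P(\eta_t=1)=q\in[0,1]$. The estimate of the data is $\hat m_t=h(\mathbb P(m_t=\cdot\mid o_{1:t},a_{1:t-1}))\in\mathcal M(n)$ for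 a given map $h$. For $c:\mathcal M(n)^2\times\{0,1\}\to\mathbb R_{\ge0}$ and $\gamma\in(0,1)$ the problem is to minimize $J(g)=\mathbb E^g\big[\sum_{t\ge1}\gamma^{t-1}c(m_t,\hat m_t,a_t)\big]$ over all strategies $g=(g_1,g_2,\dots)$. Let $T(m',m)$ be the probability that $\mathrm{emp}(s_{t+1})=m'$ when $\mathrm{emp}(s_t)=m$ (if several configurations have empirical distribution $m$, average over them uniformly; for exchangeable noise they all give the same value). Let $x_t$ be the last observation among $o_1,\dots,o_t$ that is not blank, and $y_t$ the number of blanks after it. Put $\hat f(x,y,\mathtt{blank})=(x,y+1)$, $\hat f(x,y,m)=(m,0)$ for $m\in\mathcal M(n)$, and $$\hat c(x,y,a)=\sum_{m\in\mathcal M(n)}c\big(m,h(T^y(\cdot,x)),a\big)\,T^y(m,x),$$ and let $\pi(\cdot\mid x,y,a)$ be the law on $\mathcal M(n)\cup\{\mathtt{blank}\}$ with $\pi(\mathtt{blank}\mid x,y,a)=1-aq$ and $\pi(m\mid x,y,a)=aq\,T^{y+1}(m,x)$. Theorem. Assume that $P_{\mathbf w}$ is exchangeable, that is, invariant under permutations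 of the $n$ coordinates. Then: (1) Whenever $\mathbb P(m_t=m)>0$, $\mathbb P(m_{t+1}=m'\mid m_t=m)=T(m',m)$. (2) The pair $(x_t,y_t)$ is a sufficient statistic: under every strategy, $(x_1,y_1)=(m_1,0)$ and $(x_{t+1},y_{t+1})=\hat f(x_t,y_t,o_{t+1})$. Moreover, given any history of positive probability, $\mathbb P(m_t=m\mid o_{1:t},a_{1:t-1})=T^{y_t}(m,x_t)$, $\mathbb P(o_{t+1}=o\mid o_{1:t},a_{1:t})=\pi(o\mid x_t,y_t,a_t)$ and $\mathbb E[c(m_t,\hat m_t,a_t)\mid o_{1:t},a_{1:t}]=\hat c(x_t,y_t,a_t)$. (3) All discounted sums of costs converge and are integrable. There is exactly one bounded function $V:\mathcal M(n)\times\{0,1,2,\dots\}\to\mathbb R$ with $$V(x,y)=\min_{a\in\{0,1\}}\Big(\hat c(x,y,a)+\gamma\sum_{o\in\mathcal M(n)\cup\{\mathtt{blank}\}}\pi(o\mid x,y,a)\,V(\hat f(x,y,o))\Big)\quad\text{for all }(x,y),$$ and $V\ge0$. (4) $V$ is the optimal value. For every strategy, every $t$ and every history $(o_{1:t},a_{1:t-1})$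 of positive probability, $$\mathbb E^g\Big[\sum_{k\ge0}\gamma^kc(m_{t+k},\hat m_{t+k},a_{t+k})\,\Big|\,o_{1:t},a_{1:t-1}\Big]\ge V(x_t,y_t),$$ with equality if $g$ uses actions attaining the minimum in the Bellman equation at all times from $t$ on. Every strategy $a_t=\mu(x_t,y_t)$, with $\mu(x,y)$ attaining the minimum at every $(x,y)$, minimizes $J$ over all strategies, and $\min_gJ(g)=\mathbb E[V(m_1,0)]$. -/

import Mathlib

open MeasureTheory ProbabilityTheory

noncomputable section

/-! ### Empirical distributions -/

/-- `𝓜(n)`: the empirical distributions over the finite set `S` with `n` samples, that is, the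
vectors with entries in `{0, 1/n, …, 1}` and with sum `1`. -/
def EmpDist (S : Type*) [Fintype S] (n : ℕ) : Type _ :=
  {α : S → ℝ // (∀ s, ∃ k : ℕ, k ≤ n ∧ α s = (k : ℝ) / n) ∧ ∑ s, α s = 1}

theorem EmpDist.finite (S : Type*) [Fintype S] (n : ℕ) : Finite (EmpDist S n) := by
  have hfin : (Set.pi Set.univ
      (fun _ : S => (fun k : ℕ => (k : ℝ) / n) '' Set.Iic n)).Finite :=
    Set.Finite.pi fun _ => (Set.finite_Iic n).image _
  refine Set.Finite.to_subtype (hfin.subset ?_)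
  rintro α ⟨h, -⟩ s -
  obtain ⟨k, hk, hα⟩ := h s
  exact ⟨k, hk, hα.symm⟩

instance (S : Type*) [Fintype S] (n : ℕ) : Fintype (EmpDist S n) :=
  haveI := EmpDist.finite S n
  Fintype.ofFinite _

instance (S : Type*) [Fintype S] (n : ℕ) : DecidableEq (EmpDist S n) := Classical.decEq _

/-- The empirical distribution of a configuration: `m(s) = (1/n) ∑ᵢ 𝟙{sⁱ = s}`. -/
def empirical {S : Type*} [Fintype S] [DecidableEq S] {n : ℕ} [NeZero n] (s : Fin n → S) :
    EmpDist S n :=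
  ⟨fun a => (1 / (n : ℝ)) * ∑ i, if s i = a then (1 : ℝ) else 0, by
    have hn : (n : ℝ) ≠ 0 := Nat.cast_ne_zero.mpr (NeZero.ne n)
    constructor
    · intro a
      refine ⟨(Finset.univ.filter fun i => s i = a).card, ?_, ?_⟩
      · exact (Finset.card_le_univ _).trans (by simp)
      · simp only [Finset.sum_boole]; ring
    · rw [← Finset.mul_sum, Finset.sum_comm]
      simp [hn]⟩

instance (S : Type*) [Fintype S] [DecidableEq S] [Nonempty S] (n : ℕ) [NeZero n] :
    Nonempty (EmpDist S n) :=
  ⟨empirical fun _ => Classical.arbitrary S⟩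

/-! ### Observations, actions, information, strategies

Time starts at `0` here, so that time `t` below is the `(t + 1)`-st decision instant. -/

/-- Observations: an empirical distribution, or `none`, which stands for `blank`. -/
abbrev Obs (S : Type*) [Fintype S] (n : ℕ) : Type _ := Option (EmpDist S n)

/-- The information of the decision maker at time `t`: the observations up to and including
time `t` and the actions before time `t`. The action set `{0, 1}` is `Bool`. -/
abbrev Info (S : Type*) [Fintype S] (n t : ℕ) : Type _ :=
  (Fin (t + 1) → Obs S n) × (Fin t → Bool)

/-- A strategy: a sequence of control laws, the one at time `t` maps the information at time `t`
to an action. -/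
abbrev Strategy (S : Type*) [Fintype S] (n : ℕ) : Type _ := ∀ t : ℕ, Info S n t → Bool

section Statistic

variable {S : Type*} [Fintype S] {n : ℕ}

/-- The number of blanks at the end of a sequence of observations, that is, after its last
observation that is not blank. -/
def numBlanks {t : ℕ} (o : Fin (t + 1) → Obs S n) : ℕ :=
  (Finset.univ.filter fun k : Fin (t + 1) => ∀ j, k ≤ j → o j = none).card

/-- The last credible data: the last observation that is not blank (it precedes the final run of
blanks). If all observations are blank, which never happens since the first one is credible,
the value is arbitrary. -/
def lastData [Nonempty (EmpDist S n)] {t : ℕ} (o : Fin (t + 1) → Obs S n) : EmpDist S n :=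
  (o ⟨t - numBlanks o, by omega⟩).getD (Classical.arbitrary _)

/-- The pair (last credible data, number of blanks since then). -/
def stat [Nonempty (EmpDist S n)] {t : ℕ} (H : Info S n t) : EmpDist S n × ℕ :=
  (lastData H.1, numBlanks H.1)

/-- The update of the pair by a new observation. -/
def fHat (p : EmpDist S n × ℕ) : Obs S n → EmpDist S n × ℕ
  | none => (p.1, p.2 + 1)
  | some m => (m, 0)

/-- The strategy that applies a map of the pair at all times. -/
def stationary [Nonempty (EmpDist S n)] (μ : EmpDist S n × ℕ → Bool) : Strategy S n :=
  fun _ H => μ (stat H)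

end Statistic

/-! ### The model -/

/-- The data of the problem: dynamics `f` of a node, the joint law `Pw` of the local noises at one
time instant, credibility probability `q`, discount factor `γ`, per-step cost `c` (arguments:
data, estimate, action) and estimator `h`. The estimator is a function of probability mass
functions on `𝓜(n)`; its values at other vectors play no role. -/
structure DataModel (S W : Type*) [Fintype S] [MeasurableSpace S] [MeasurableSpace W]
    (n : ℕ) where
  f : S → EmpDist S n → W → S
  measurable_f : ∀ s m, Measurable (f s m)
  Pw : Measure (Fin n → W)
  isProbabilityMeasure_Pw : IsProbabilityMeasure Pw
  q : ℝ
  q_mem : q ∈ Set.Icc (0 : ℝ) 1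
  γ : ℝ
  γ_mem : γ ∈ Set.Ioo (0 : ℝ) 1
  c : EmpDist S n → EmpDist S n → Bool → ℝ
  c_nonneg : ∀ m m' a, 0 ≤ c m m' a
  h : (EmpDist S n → ℝ) → EmpDist S n

namespace DataModel

variable {S W : Type*} [Fintype S] [DecidableEq S] [MeasurableSpace S] [MeasurableSpace W]
  {n : ℕ} [NeZero n] (D : DataModel S W n)

/-- Exchangeable noise: the joint law of `w¹, …, wⁿ` is invariant under permutations. -/
def Exchangeable : Prop :=
  ∀ σ : Equiv.Perm (Fin n), D.Pw.map (fun w i => w (σ i)) = D.Pw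

/-- One step of the dynamics of all nodes: `sⁱ ↦ f(sⁱ, m, wⁱ)`, `m` the empirical distribution. -/
def step (s : Fin n → S) (w : Fin n → W) : Fin n → S :=
  fun i => D.f (s i) (empirical s) (w i)

/-- The transition matrix of the empirical distribution: entry `(m', m)` is the probability that
the next empirical distribution is `m'` if the current configuration is uniformly distributed
over the configurations with empirical distribution `m`. (For exchangeable noise all these
configurations give the same probability.) -/
def Tm : Matrix (EmpDist S n) (EmpDist S n) ℝ := fun m' m =>
  (∑ s : Fin n → S with empirical s = m, D.Pw.real {w | empirical (D.step s w) = m'}) /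
    ((Finset.univ.filter fun s : Fin n → S => empirical s = m).card : ℝ)

/-- The law of the next observation given the pair `p` and the action `a`. -/
def obsLaw (p : EmpDist S n × ℕ) (a : Bool) : Obs S n → ℝ
  | none => 1 - (a.toNat : ℝ) * D.q
  | some m => (a.toNat : ℝ) * D.q * (D.Tm ^ (p.2 + 1)) m p.1

/-- The expected per-step cost at the pair `p` and the action `a`. -/
def cHat (p : EmpDist S n × ℕ) (a : Bool) : ℝ :=
  ∑ m, D.c m (D.h fun m' => (D.Tm ^ p.2) m' p.1) a * (D.Tm ^ p.2) m p.1

/-- The expression minimized in the Bellman equation: `ĉ(x,y,a) + γ 𝔼 V(f̂(x,y,o))`. -/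
def qValue (V : EmpDist S n × ℕ → ℝ) (p : EmpDist S n × ℕ) (a : Bool) : ℝ :=
  D.cHat p a + D.γ * ∑ o : Obs S n, D.obsLaw p a o * V (fHat p o)

/-- `V` solves the Bellman equation. -/
def IsBellman (V : EmpDist S n × ℕ → ℝ) : Prop :=
  ∀ p, V p = min (D.qValue V p false) (D.qValue V p true)

/-- The action `a` attains the minimum in the Bellman equation at the pair `p`. -/
def IsGreedy (V : EmpDist S n × ℕ → ℝ) (p : EmpDist S n × ℕ) (a : Bool) : Prop :=
  ∀ a', D.qValue V p a ≤ D.qValue V p a'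

/-! ### Primitive random variables and closed-loop processes -/

/-- The primitive random variables on a probability space: initial configuration `s₀` (of any
law), local noises `w t` of law `Pw`, credibility variables `η t`, Bernoulli of parameter `q`; all
mutually independent. -/
structure Primitives {Ω : Type*} [MeasurableSpace Ω] (P : Measure Ω) where
  s₀ : Ω → Fin n → S
  w : ℕ → Ω → Fin n → W
  η : ℕ → Ω → Bool
  measurable_s₀ : Measurable s₀
  measurable_w : ∀ t, Measurable (w t)
  measurable_η : ∀ t, Measurable (η t)
  map_w : ∀ t, P.map (w t) = D.Pw
  prob_η : ∀ t, P.real {ω | η t ω = true} = D.q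
  indep : iIndep
    (Sum.elim (fun _ : Unit => MeasurableSpace.comap s₀ inferInstance)
      (Sum.elim (fun t : ℕ => MeasurableSpace.comap (w t) inferInstance)
        (fun t : ℕ => MeasurableSpace.comap (η t) inferInstance))) P

namespace Primitives

variable {D} {Ω : Type*} [MeasurableSpace Ω] {P : Measure Ω} (ξ : D.Primitives P)

/-- The states of all nodes at time `t`. -/
def state : ℕ → Ω → Fin n → S
  | 0, ω => ξ.s₀ ω
  | t + 1, ω => D.step (state t ω) (ξ.w t ω)

/-- The data: the empirical distribution of the states at time `t`. -/
def data (t : ℕ) (ω : Ω) : EmpDist S n := empirical (ξ.state t ω)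

/-- The information of the decision maker at time `t` under the strategy `g`. The first
observation is the initial data. The observation at time `t + 1` is the data at time `t + 1` if
they are collected (`a_t = 1`) and credible (`η_t = 1`), and blank otherwise. -/
def info (g : Strategy S n) : (t : ℕ) → Ω → Info S n t
  | 0, ω => (fun _ => some (ξ.data 0 ω), Fin.elim0)
  | t + 1, ω =>
    (Fin.snoc (α := fun _ => Obs S n) (info g t ω).1
        (if g t (info g t ω) = true ∧ ξ.η t ω = true then some (ξ.data (t + 1) ω) else none),
      Fin.snoc (α := fun _ => Bool) (info g t ω).2 (g t (info g t ω)))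

/-- The action at time `t` under the strategy `g`. -/
def action (g : Strategy S n) (t : ℕ) (ω : Ω) : Bool := g t (ξ.info g t ω)

/-- The observation at time `t` under the strategy `g`. -/
def obs (g : Strategy S n) (t : ℕ) (ω : Ω) : Obs S n := (ξ.info g t ω).1 (Fin.last t)

/-- The event that the information at time `t` under the strategy `g` is `H`. -/
def infoEvent (g : Strategy S n) {t : ℕ} (H : Info S n t) : Set Ω := {ω | ξ.info g t ω = H}

/-- The event that the information at time `t` is `H` and the action at time `t` is `a`. -/
def infoActionEvent (g : Strategy S n) {t : ℕ} (H : Info S n t) (a : Bool) : Set Ω :=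
  {ω | ξ.info g t ω = H ∧ ξ.action g t ω = a}

/-- The conditional law of the data at time `t` given that the information at time `t` under the
strategy `g` is `H`. -/
def belief (g : Strategy S n) {t : ℕ} (H : Info S n t) : EmpDist S n → ℝ :=
  fun m => (cond P (ξ.infoEvent g H)).real {ω | ξ.data t ω = m}

/-- The estimate of the data at time `t`: the estimator applied to the conditional law of the data
given the realized information. -/
def estimate (g : Strategy S n) (t : ℕ) (ω : Ω) : EmpDist S n :=
  D.h (ξ.belief g (ξ.info g t ω))

/-- The cost incurred at time `t` under the strategy `g`. -/
def cost (g : Strategy S n) (t : ℕ) (ω : Ω) : ℝ :=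
  D.c (ξ.data t ω) (ξ.estimate g t ω) (ξ.action g t ω)

/-- The total discounted cost from time `t` on, discounted to time `t`. -/
def tailCost (g : Strategy S n) (t : ℕ) (ω : Ω) : ℝ := ∑' k : ℕ, D.γ ^ k * ξ.cost g (t + k) ω

/-- The total expected discounted cost of the strategy `g`. -/
def J (g : Strategy S n) : ℝ := ∫ ω, ξ.tailCost g 0 ω ∂P

end Primitives

end DataModel

end

-- The dynamics treat all nodes alike and the noise is exchangeable, so two configurations that
-- differ by a permutation, i.e. have the same empirical distribution, give the same law to the next
-- empirical distribution. Hence on any event of the past the data move by `Tm`, independently of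
-- the current credibility variable (`real_past_inter_data_transition`). Given the history, the
-- action is fixed, so whether a blank occurs depends only on `η t`, which is independent of the
-- past and of the transition. A blank thus carries no information on the data and only adds one
-- factor `Tm` to their conditional law, while credible data reset it to a point mass. Induction on
-- time gives `real_infoEvent_inter_data`, from which the laws of the next observation and the mean
-- cost follow. The Bellman operator is a `γ`-contraction in the sup norm, since `obsLaw` is
-- nonnegative with total mass at most one. For optimality, let Z_t be `V` at the current pair minus
-- the cost-to-go. On each history event the integral of Z_t is the Bellman gap (nonpositive, zero
-- for minimizing actions), weighted by the probability of the event, plus `γ` times the integral of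
-- Z_{t+1} (`setIntegral_stat_sub_tailCost`). As Z is bounded, iteration makes the gap's sign the
-- sign of the integral; for minimizing actions the argument also applies to -Z and gives equality.

noncomputable section

set_option linter.unusedSectionVars false

-- Bounded fixed points of a sup-norm contraction

/-- A contraction of bounded functions for the uniform distance has exactly one bounded fixed
point. -/
theorem existsUnique_bounded_fixedPoint {α : Type*} (B : (α → ℝ) → α → ℝ) {γ : ℝ}
    (hγ0 : 0 ≤ γ) (hγ1 : γ < 1)
    (hB : ∀ V, (∃ C, ∀ p, |V p| ≤ C) → ∃ C, ∀ p, |B V p| ≤ C)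
    (hcontr : ∀ V V' C, (∀ p, |V p - V' p| ≤ C) → ∀ p, |B V p - B V' p| ≤ γ * C) :
    ∃! V : α → ℝ, (∃ C, ∀ p, |V p| ≤ C) ∧ ∀ p, V p = B V p := by
  -- With the discrete topology every bounded function is continuous, so Banach's theorem applies in
  -- the complete space of bounded continuous functions.
  let _ : TopologicalSpace α := ⊥
  have : DiscreteTopology α := ⟨rfl⟩
  have hbd : ∀ V : BoundedContinuousFunction α ℝ, ∃ C, ∀ p, |V p| ≤ C :=
    fun V => ⟨‖V‖, fun p => V.norm_coe_le_norm p⟩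
  choose C hC using fun V : BoundedContinuousFunction α ℝ => hB V (hbd V)
  let Φ : BoundedContinuousFunction α ℝ → BoundedContinuousFunction α ℝ := fun V =>
    BoundedContinuousFunction.ofNormedAddCommGroupDiscrete (B V) (C V) (hC V)
  have hΦ : ∀ V p, Φ V p = B V p := fun V p => rfl
  have hc : ContractingWith ⟨γ, hγ0⟩ Φ := by
    refine ⟨by exact_mod_cast hγ1, LipschitzWith.of_dist_le_mul fun V V' => ?_⟩
    refine (BoundedContinuousFunction.dist_le (by positivity)).2 fun p => ?_
    rw [Real.dist_eq, hΦ, hΦ]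
    exact hcontr _ _ _ (fun p => by
      rw [← Real.dist_eq]; exact BoundedContinuousFunction.dist_coe_le_dist p) p
  refine ⟨hc.fixedPoint, ⟨hbd _, fun p => ?_⟩, ?_⟩
  · rw [← hΦ, hc.fixedPoint_isFixedPt]
  · rintro V ⟨⟨K, hK⟩, hV⟩
    let V' := BoundedContinuousFunction.ofNormedAddCommGroupDiscrete V K hK
    have : V' = hc.fixedPoint := hc.fixedPoint_unique (by
      ext p; rw [hΦ]; exact (hV p).symm)
    rw [← this]; rfl

/-! ### Empirical distributions and permutations -/

theorem empirical_apply {S : Type*} [Fintype S] [DecidableEq S] {n : ℕ} [NeZero n]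
    (s : Fin n → S) (a : S) :
    (empirical s).1 a = (1 / (n : ℝ)) * (Fintype.card {i // s i = a} : ℝ) := by
  simp [empirical, Fintype.card_subtype]

theorem empirical_comp_perm {S : Type*} [Fintype S] [DecidableEq S] {n : ℕ} [NeZero n]
    (s : Fin n → S) (σ : Equiv.Perm (Fin n)) :
    empirical (fun i => s (σ i)) = empirical s := by
  apply Subtype.ext
  funext a
  simp only [empirical]
  rw [Equiv.sum_comp σ fun i => if s i = a then (1 : ℝ) else 0]

/-- Equal empirical distributions mean fibres of equal size over each state; bijections between the
fibres glue to a permutation. -/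
theorem exists_perm_of_empirical_eq {S : Type*} [Fintype S] [DecidableEq S] {n : ℕ} [NeZero n]
    {s s' : Fin n → S} (h : empirical s = empirical s') :
    ∃ σ : Equiv.Perm (Fin n), s' = fun i => s (σ i) := by
  have hcard : ∀ a, Fintype.card {i // s' i = a} = Fintype.card {i // s i = a} := by
    intro a
    have := congrArg (fun m => m.1 a) h
    simp only [empirical_apply] at this
    have hn : (1 / (n : ℝ)) ≠ 0 := one_div_ne_zero (Nat.cast_ne_zero.mpr (NeZero.ne n))
    exact_mod_cast (mul_left_cancel₀ hn this).symm
  refine ⟨Equiv.ofFiberEquiv fun a => Fintype.equivOfCardEq (hcard a), ?_⟩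
  funext i
  exact (Equiv.ofFiberEquiv_map _ i).symm

/-! ### The update of the statistic -/

section Statistic

variable {S : Type*} [Fintype S] {n : ℕ}

theorem numBlanks_snoc_none {t : ℕ} (o : Fin (t + 1) → Obs S n) :
    numBlanks (Fin.snoc (α := fun _ => Obs S n) o none) = numBlanks o + 1 := by
  unfold numBlanks
  rw [Finset.card_filter, Fin.sum_univ_castSucc, ← Finset.card_filter]
  congr 1
  · congr 1
    ext k
    simp [Fin.forall_fin_succ']
  · rw [if_pos]
    intro j hj
    obtain rfl : j = Fin.last (t + 1) := Fin.last_le_iff.1 hj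
    simp

theorem numBlanks_snoc_some {t : ℕ} (o : Fin (t + 1) → Obs S n) (m : EmpDist S n) :
    numBlanks (Fin.snoc (α := fun _ => Obs S n) o (some m)) = 0 := by
  unfold numBlanks
  rw [Finset.card_eq_zero, Finset.filter_eq_empty_iff]
  intro k _ hk
  simpa using hk (Fin.last (t + 1)) (Fin.le_last k)

theorem stat_zero_some [Nonempty (EmpDist S n)] (H : Info S n 0) {m : EmpDist S n}
    (h : H.1 0 = some m) : stat H = (m, 0) := by
  have h0 : numBlanks H.1 = 0 := by
    unfold numBlanks
    rw [Finset.card_eq_zero, Finset.filter_eq_empty_iff]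
    intro k _ hk
    have := hk 0 (Fin.le_of_eq (Subsingleton.elim (α := Fin 1) k 0))
    simp [h] at this
  simp [stat, lastData, h0, h]

/-- A blank lengthens both the sequence and its final run by one, so the position `t - numBlanks o`
of the last credible data does not move. -/
theorem stat_snoc [Nonempty (EmpDist S n)] {t : ℕ} (o : Fin (t + 1) → Obs S n)
    (a : Fin t → Bool) (a' : Fin (t + 1) → Bool) (o' : Obs S n) :
    stat (t := t + 1) (Fin.snoc (α := fun _ => Obs S n) o o', a') =
      fHat (stat (t := t) (o, a)) o' := by
  cases o' with
  | none =>
    refine Prod.ext ?_ (numBlanks_snoc_none o)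
    simp only [stat, fHat, lastData, numBlanks_snoc_none]
    congr 1
    have : (⟨t + 1 - (numBlanks o + 1), by omega⟩ : Fin (t + 1 + 1)) =
        Fin.castSucc ⟨t - numBlanks o, by omega⟩ := by
      ext; simp
    rw [this, Fin.snoc_castSucc]
  | some m =>
    refine Prod.ext ?_ (numBlanks_snoc_some o m)
    simp only [stat, fHat, lastData, numBlanks_snoc_some]
    have : (⟨t + 1 - 0, by omega⟩ : Fin (t + 1 + 1)) = Fin.last (t + 1) := rfl
    rw [this, Fin.snoc_last]
    rfl

end Statistic

/-! ### The transition matrix -/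

namespace DataModel

variable {S W : Type*} [Fintype S] [DecidableEq S] [MeasurableSpace S] [MeasurableSpace W]
  {n : ℕ} [NeZero n] (D : DataModel S W n)

theorem measurable_step (s : Fin n → S) : Measurable (D.step s) :=
  measurable_pi_lambda _ fun i => (D.measurable_f _ _).comp (measurable_pi_apply i)

theorem measurableSet_step_mem [MeasurableSingletonClass S] (s : Fin n → S)
    (A : Set (Fin n → S)) : MeasurableSet {w | D.step s w ∈ A} :=
  D.measurable_step s A.toFinite.measurableSet

theorem step_perm (s : Fin n → S) (w : Fin n → W) (σ : Equiv.Perm (Fin n)) :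
    D.step (fun i => s (σ i)) (fun i => w (σ i)) = fun i => D.step s w (σ i) := by
  funext i
  simp only [step, empirical_comp_perm]

variable [MeasurableSingletonClass S]

/-- The one place where exchangeability itself acts: permuting states and noises together permutes
the next configuration (`step_perm`), which leaves its empirical distribution unchanged. -/
theorem real_step_eq_of_empirical_eq (hexch : D.Exchangeable) {s s' : Fin n → S}
    (h : empirical s = empirical s') (m' : EmpDist S n) :
    D.Pw.real {w | empirical (D.step s' w) = m'} =
      D.Pw.real {w | empirical (D.step s w) = m'} := by
  obtain ⟨σ, rfl⟩ := exists_perm_of_empirical_eq h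
  have hm : Measurable fun (w : Fin n → W) (i : Fin n) => w (σ i) :=
    measurable_pi_lambda _ fun i => measurable_pi_apply _
  conv_lhs => rw [← hexch σ]
  refine (map_measureReal_apply hm
    (D.measurableSet_step_mem _ {r | empirical r = m'})).trans ?_
  congr 1
  ext w
  simp only [Set.preimage_ofPred_eq, Set.mem_ofPred_eq]
  rw [step_perm, empirical_comp_perm]

theorem real_step_eq_Tm (hexch : D.Exchangeable) (s : Fin n → S) (m' : EmpDist S n) :
    D.Pw.real {w | empirical (D.step s w) = m'} = D.Tm m' (empirical s) := by
  have hpos : ((Finset.univ.filter fun r : Fin n → S =>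
      empirical r = empirical s).card : ℝ) ≠ 0 :=
    Nat.cast_ne_zero.2 (Finset.card_ne_zero_of_mem (a := s) (by simp))
  rw [Tm, eq_div_iff hpos, Finset.sum_congr rfl fun r hr =>
    D.real_step_eq_of_empirical_eq hexch (Finset.mem_filter.1 hr).2.symm m']
  rw [Finset.sum_const, nsmul_eq_mul, mul_comm]

theorem Tm_nonneg (m' m : EmpDist S n) : 0 ≤ D.Tm m' m :=
  div_nonneg (Finset.sum_nonneg fun _ _ => measureReal_nonneg) (Nat.cast_nonneg _)

/-- The inequality is all that the contraction and nonnegativity arguments need, and it avoids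
showing that every element of `EmpDist S n` comes from a configuration. -/
theorem sum_Tm_le_one (m : EmpDist S n) : ∑ m', D.Tm m' m ≤ 1 := by
  have := D.isProbabilityMeasure_Pw
  simp only [Tm]
  rw [← Finset.sum_div, Finset.sum_comm]
  -- This also covers an empty set of configurations, where division by zero gives `0`.
  refine div_le_one_of_le₀ ?_ (Nat.cast_nonneg _)
  rw [← nsmul_one, ← Finset.sum_const]
  refine Finset.sum_le_sum fun s _ => ?_
  rw [← measureReal_biUnion_finset]
  · exact measureReal_le_one
  · intro a _ b _ hab
    exact Set.disjoint_left.2 fun w hw hw' => hab (hw.symm.trans hw')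
  · intro m' _
    exact D.measurableSet_step_mem s {r | empirical r = m'}

theorem Tm_pow_nonneg (k : ℕ) (m' m : EmpDist S n) : 0 ≤ (D.Tm ^ k) m' m := by
  induction k generalizing m' with
  | zero => rw [pow_zero, Matrix.one_apply]; split_ifs <;> norm_num
  | succ k ih =>
    rw [pow_succ', Matrix.mul_apply]
    exact Finset.sum_nonneg fun j _ => mul_nonneg (D.Tm_nonneg _ _) (ih _)

theorem sum_Tm_pow_le_one (k : ℕ) (m : EmpDist S n) : ∑ m', (D.Tm ^ k) m' m ≤ 1 := by
  induction k with
  | zero => simp [Matrix.one_apply]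
  | succ k ih =>
    simp only [pow_succ', Matrix.mul_apply]
    rw [Finset.sum_comm]
    refine le_trans (Finset.sum_le_sum fun j _ => ?_) ih
    rw [← Finset.sum_mul]
    exact mul_le_of_le_one_left (D.Tm_pow_nonneg _ _ _) (D.sum_Tm_le_one j)

/-! ### The Bellman operator -/

theorem toNat_mul_q_mem (a : Bool) : (a.toNat : ℝ) * D.q ∈ Set.Icc (0 : ℝ) 1 := by
  cases a
  · simp
  · simpa using D.q_mem

theorem obsLaw_nonneg (p : EmpDist S n × ℕ) (a : Bool) (o : Obs S n) : 0 ≤ D.obsLaw p a o := by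
  have h := D.toNat_mul_q_mem a
  cases o with
  | none => exact sub_nonneg.2 h.2
  | some m => exact mul_nonneg h.1 (D.Tm_pow_nonneg _ _ _)

theorem sum_obsLaw_le_one (p : EmpDist S n × ℕ) (a : Bool) : ∑ o, D.obsLaw p a o ≤ 1 := by
  have h := D.toNat_mul_q_mem a
  rw [Fintype.sum_option]
  simp only [obsLaw]
  rw [← Finset.mul_sum]
  nlinarith [mul_le_mul_of_nonneg_left (D.sum_Tm_pow_le_one (p.2 + 1) p.1) h.1]

theorem cHat_nonneg (p : EmpDist S n × ℕ) (a : Bool) : 0 ≤ D.cHat p a :=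
  Finset.sum_nonneg fun _ _ => mul_nonneg (D.c_nonneg _ _ _) (D.Tm_pow_nonneg _ _ _)

theorem exists_cost_bound : ∃ C, 0 ≤ C ∧ ∀ m m' a, D.c m m' a ≤ C := by
  refine ⟨∑ x : EmpDist S n × EmpDist S n × Bool, D.c x.1 x.2.1 x.2.2,
    Finset.sum_nonneg fun _ _ => D.c_nonneg _ _ _, fun m m' a => ?_⟩
  exact Finset.single_le_sum (f := fun x : EmpDist S n × EmpDist S n × Bool => D.c x.1 x.2.1 x.2.2)
    (fun _ _ => D.c_nonneg _ _ _) (Finset.mem_univ (m, m', a))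

theorem cHat_le {C : ℝ} (hC0 : 0 ≤ C) (hC : ∀ m m' a, D.c m m' a ≤ C) (p : EmpDist S n × ℕ)
    (a : Bool) : D.cHat p a ≤ C := by
  calc D.cHat p a ≤ ∑ m, C * (D.Tm ^ p.2) m p.1 :=
        Finset.sum_le_sum fun m _ => mul_le_mul_of_nonneg_right (hC _ _ _) (D.Tm_pow_nonneg _ _ _)
    _ ≤ C := by
        rw [← Finset.mul_sum]
        exact mul_le_of_le_one_right hC0 (D.sum_Tm_pow_le_one _ _)

theorem sum_obsLaw_mul_le {U : EmpDist S n × ℕ → ℝ} {C : ℝ} (hU : ∀ p, |U p| ≤ C)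
    (p : EmpDist S n × ℕ) (a : Bool) : |∑ o, D.obsLaw p a o * U (fHat p o)| ≤ C := by
  have hC : 0 ≤ C := (abs_nonneg _).trans (hU p)
  calc |∑ o, D.obsLaw p a o * U (fHat p o)| ≤ ∑ o, D.obsLaw p a o * C :=
        (Finset.abs_sum_le_sum_abs _ _).trans <| Finset.sum_le_sum fun o _ => by
          rw [abs_mul, abs_of_nonneg (D.obsLaw_nonneg p a o)]
          exact mul_le_mul_of_nonneg_left (hU _) (D.obsLaw_nonneg p a o)
    _ ≤ C := by
        rw [← Finset.sum_mul]
        exact mul_le_of_le_one_left hC (D.sum_obsLaw_le_one p a)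

/-- The expected costs cancel, and what remains is `γ` times a sum against a subprobability. -/
theorem abs_qValue_sub_le {V V' : EmpDist S n × ℕ → ℝ} {C : ℝ} (h : ∀ p, |V p - V' p| ≤ C)
    (p : EmpDist S n × ℕ) (a : Bool) : |D.qValue V p a - D.qValue V' p a| ≤ D.γ * C := by
  have : D.qValue V p a - D.qValue V' p a =
      D.γ * ∑ o, D.obsLaw p a o * (fun x => V x - V' x) (fHat p o) := by
    simp only [qValue, mul_sub, Finset.sum_sub_distrib]
    ring
  rw [this, abs_mul, abs_of_pos D.γ_mem.1]
  exact mul_le_mul_of_nonneg_left (D.sum_obsLaw_mul_le h p a) D.γ_mem.1.le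

theorem abs_qValue_le {V : EmpDist S n × ℕ → ℝ} {C K : ℝ} (h : ∀ p, |V p| ≤ C)
    (hK0 : 0 ≤ K) (hK : ∀ m m' a, D.c m m' a ≤ K)
    (p : EmpDist S n × ℕ) (a : Bool) : |D.qValue V p a| ≤ K + D.γ * C := by
  refine (abs_add_le _ _).trans (add_le_add ?_ ?_)
  · rw [abs_of_nonneg (D.cHat_nonneg p a)]
    exact D.cHat_le hK0 hK p a
  · rw [abs_mul, abs_of_pos D.γ_mem.1]
    exact mul_le_mul_of_nonneg_left (D.sum_obsLaw_mul_le h p a) D.γ_mem.1.le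

theorem existsUnique_isBellman :
    ∃! V : EmpDist S n × ℕ → ℝ, (∃ C, ∀ p, |V p| ≤ C) ∧ D.IsBellman V := by
  refine existsUnique_bounded_fixedPoint
    (fun V p => min (D.qValue V p false) (D.qValue V p true)) D.γ_mem.1.le D.γ_mem.2 ?_ ?_
  · rintro V ⟨C, hC⟩
    obtain ⟨K, hK0, hK⟩ := D.exists_cost_bound
    exact ⟨_, fun p => abs_min_le_max_abs_abs.trans
      (max_le (D.abs_qValue_le hC hK0 hK p false) (D.abs_qValue_le hC hK0 hK p true))⟩
  · intro V V' C h p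
    exact (abs_min_sub_min_le_max _ _ _ _).trans
      (max_le (D.abs_qValue_sub_le h p false) (D.abs_qValue_sub_le h p true))

theorem IsBellman.le_qValue {D : DataModel S W n} {V : EmpDist S n × ℕ → ℝ}
    (hV : D.IsBellman V) (p : EmpDist S n × ℕ) (a : Bool) : V p ≤ D.qValue V p a := by
  rw [hV p]
  cases a
  · exact min_le_left _ _
  · exact min_le_right _ _

theorem IsBellman.eq_qValue {D : DataModel S W n} {V : EmpDist S n × ℕ → ℝ}
    (hV : D.IsBellman V) {p : EmpDist S n × ℕ} {a : Bool} (ha : D.IsGreedy V p a) :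
    V p = D.qValue V p a :=
  le_antisymm (hV.le_qValue p a) (by rw [hV p]; exact le_min (ha _) (ha _))

theorem exists_isGreedy (V : EmpDist S n × ℕ → ℝ) (p : EmpDist S n × ℕ) :
    ∃ a, D.IsGreedy V p a := by
  obtain ⟨a, ha⟩ := Finite.exists_min (D.qValue V p)
  exact ⟨a, ha⟩

theorem IsBellman.nonneg {D : DataModel S W n} {V : EmpDist S n × ℕ → ℝ}
    (hV : D.IsBellman V) (hb : ∃ C, ∀ p, |V p| ≤ C) (p : EmpDist S n × ℕ) : 0 ≤ V p := by
  obtain ⟨C, hC⟩ := hb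
  have hC0 : 0 ≤ C := (abs_nonneg _).trans (hC p)
  -- Each use of the Bellman equation improves the lower bound `-C` by a factor `γ`, because the
  -- costs are nonnegative.
  have key : ∀ (N : ℕ) (p : EmpDist S n × ℕ), -(D.γ ^ N * C) ≤ V p := by
    intro N
    induction N with
    | zero => intro p; simpa using (abs_le.1 (hC p)).1
    | succ N ih =>
      intro p
      obtain ⟨a, ha⟩ := D.exists_isGreedy V p
      rw [hV.eq_qValue ha, qValue, pow_succ', mul_assoc, ← mul_neg]
      refine (mul_le_mul_of_nonneg_left ?_ D.γ_mem.1.le).trans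
        (le_add_of_nonneg_left (D.cHat_nonneg p a))
      have hN : 0 ≤ D.γ ^ N * C := mul_nonneg (pow_nonneg D.γ_mem.1.le _) hC0
      -- The bound is nonpositive, so total mass at most one goes in the right direction.
      calc -(D.γ ^ N * C) ≤ (∑ o, D.obsLaw p a o) * -(D.γ ^ N * C) := by
            nlinarith [D.sum_obsLaw_le_one p a]
        _ ≤ ∑ o, D.obsLaw p a o * V (fHat p o) := by
            rw [Finset.sum_mul]
            exact Finset.sum_le_sum fun o _ =>
              mul_le_mul_of_nonneg_left (ih _) (D.obsLaw_nonneg p a o)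
  have hlim : Filter.Tendsto (fun N : ℕ => -(D.γ ^ N * C)) Filter.atTop (nhds 0) := by
    simpa using ((tendsto_pow_atTop_nhds_zero_of_lt_one D.γ_mem.1.le D.γ_mem.2).mul_const C).neg
  exact le_of_tendsto hlim (Filter.Eventually.of_forall fun N => key N p)

end DataModel

-- Discrete measurability, conditioning on events, integrals over fibres

/-- A pair of maps to discrete countable spaces is measurable. -/
theorem measurable_top_prodMk {Ω α β : Type*} [Countable α] [Countable β] {m : MeasurableSpace Ω}
    {X : Ω → α} {Y : Ω → β} (hX : @Measurable _ _ m ⊤ X) (hY : @Measurable _ _ m ⊤ Y) :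
    @Measurable _ _ m ⊤ fun ω => (X ω, Y ω) := by
  let _ : MeasurableSpace (α × β) := ⊤
  refine measurable_to_countable' fun p => ?_
  have : (fun ω => (X ω, Y ω)) ⁻¹' {p} = X ⁻¹' {p.1} ∩ Y ⁻¹' {p.2} := by
    ext ω; simp [Prod.ext_iff]
  rw [this]
  exact (hX trivial).inter (hY trivial)

/-- Trades conditional probabilities for the product form, which makes sense on null events and can
be summed and carried through inductions. -/
theorem cond_real_eq_iff {Ω : Type*} [MeasurableSpace Ω] {P : Measure Ω} [IsFiniteMeasure P]
    {E : Set Ω} (hE : MeasurableSet E) (h : P E ≠ 0) (A : Set Ω) (r : ℝ) :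
    (cond P E).real A = r ↔ P.real (E ∩ A) = P.real E * r := by
  have hne : P.real E ≠ 0 := by rwa [Ne, measureReal_eq_zero_iff]
  rw [measureReal_def, cond_apply hE, ENNReal.toReal_mul, ENNReal.toReal_inv, ← measureReal_def,
    ← measureReal_def, inv_mul_eq_iff_eq_mul₀ hne]

theorem integral_cond_eq {Ω : Type*} [MeasurableSpace Ω] {P : Measure Ω} (E : Set Ω)
    (φ : Ω → ℝ) : ∫ ω, φ ω ∂(cond P E) = (P.real E)⁻¹ * ∫ ω in E, φ ω ∂P := by
  rw [ProbabilityTheory.cond, integral_smul_measure, ENNReal.toReal_inv, smul_eq_mul, measureReal_def]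

theorem setIntegral_eq_sum_fibers {Ω α : Type*} [Fintype α] [MeasurableSpace Ω] {P : Measure Ω}
    {E : Set Ω} (hE : MeasurableSet E) {X : Ω → α} (hX : ∀ a, MeasurableSet {ω | X ω = a})
    {φ : Ω → ℝ} (hφ : Integrable φ P) :
    ∫ ω in E, φ ω ∂P = ∑ a, ∫ ω in E ∩ {ω | X ω = a}, φ ω ∂P := by
  rw [← integral_iUnion_fintype (fun a => hE.inter (hX a))
    (fun a b hab => Set.disjoint_left.2 fun ω h h' => hab (h.2.symm.trans h'.2))
    fun a => hφ.integrableOn]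
  congr 2
  ext ω
  simp

theorem setIntegral_eq_real_mul {Ω : Type*} [MeasurableSpace Ω] {P : Measure Ω}
    {E : Set Ω} (hE : MeasurableSet E) {φ : Ω → ℝ} {r : ℝ} (h : ∀ ω ∈ E, φ ω = r) :
    ∫ ω in E, φ ω ∂P = P.real E * r := by
  rw [setIntegral_congr_fun hE h, setIntegral_const, smul_eq_mul]

namespace DataModel.Primitives

variable {S W Ω : Type*} [Fintype S] [DecidableEq S] [MeasurableSpace S] [MeasurableSpace W]
  {n : ℕ} [NeZero n] {D : DataModel S W n} [MeasurableSpace Ω] {P : Measure Ω}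
  (ξ : D.Primitives P)

/-! ### The past -/

/-- The sigma-algebras generated by the primitive random variables. -/
abbrev source : Unit ⊕ ℕ ⊕ ℕ → MeasurableSpace Ω :=
  Sum.elim (fun _ : Unit => MeasurableSpace.comap ξ.s₀ inferInstance)
    (Sum.elim (fun t : ℕ => MeasurableSpace.comap (ξ.w t) inferInstance)
      (fun t : ℕ => MeasurableSpace.comap (ξ.η t) inferInstance))

/-- The indices of the primitive random variables that precede the transition out of time `t`. -/
def pastIndex (t : ℕ) : Set (Unit ⊕ ℕ ⊕ ℕ) :=
  {i | Sum.elim (fun _ => True) (Sum.elim (· < t) (· < t)) i}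

/-- The sigma-algebra of the events that precede the transition out of time `t`. -/
abbrev past (t : ℕ) : MeasurableSpace Ω := ⨆ i ∈ pastIndex t, ξ.source i

theorem source_le (i : Unit ⊕ ℕ ⊕ ℕ) : ξ.source i ≤ ‹MeasurableSpace Ω› := by
  rcases i with _ | t | t
  · exact ξ.measurable_s₀.comap_le
  · exact (ξ.measurable_w t).comap_le
  · exact (ξ.measurable_η t).comap_le

theorem past_le (t : ℕ) : ξ.past t ≤ ‹MeasurableSpace Ω› := iSup₂_le fun i _ => ξ.source_le i

theorem past_le_succ (t : ℕ) : ξ.past t ≤ ξ.past (t + 1) := by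
  refine biSup_mono fun i hi => ?_
  rcases i with _ | k | k
  · trivial
  · exact Nat.lt_succ_of_lt hi
  · exact Nat.lt_succ_of_lt hi

theorem measurable_s₀_past : Measurable[ξ.past 0] ξ.s₀ :=
  measurable_iff_comap_le.2 (le_iSup₂_of_le (f := fun i _ => ξ.source i) (Sum.inl ())
    trivial le_rfl)

theorem measurable_w_past (t : ℕ) : Measurable[ξ.past (t + 1)] (ξ.w t) :=
  measurable_iff_comap_le.2 (le_iSup₂_of_le (f := fun i _ => ξ.source i) (Sum.inr (Sum.inl t))
    (Nat.lt_succ_self t) le_rfl)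

theorem measurable_η_past (t : ℕ) : Measurable[ξ.past (t + 1)] (ξ.η t) :=
  measurable_iff_comap_le.2 (le_iSup₂_of_le (f := fun i _ => ξ.source i) (Sum.inr (Sum.inr t))
    (Nat.lt_succ_self t) le_rfl)

/-- `past t` involves only noises and credibility variables of index below `t`, while `w t` and `η
t` drive the transition to time `t + 1`. Independence is used twice: the past against `w t`, then
both together against `η t`. -/
theorem real_past_inter_transition {t : ℕ} {E : Set Ω}
    (hE : MeasurableSet[ξ.past t] E) {A : Set (Fin n → W)} (hA : MeasurableSet A) (B : Set Bool) :
    P.real (E ∩ ξ.w t ⁻¹' A ∩ ξ.η t ⁻¹' B) = P.real E * D.Pw.real A * P.real (ξ.η t ⁻¹' B) := by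
  have hwA : MeasurableSet[ξ.source (Sum.inr (Sum.inl t))] (ξ.w t ⁻¹' A) := ⟨A, hA, rfl⟩
  have hηB : MeasurableSet[ξ.source (Sum.inr (Sum.inr t))] (ξ.η t ⁻¹' B) := ⟨B, trivial, rfl⟩
  have h1 : Indep (ξ.past t) (⨆ i ∈ ({Sum.inr (Sum.inl t)} : Set _), ξ.source i) P :=
    indep_iSup_of_disjoint ξ.source_le ξ.indep
      (Set.disjoint_singleton_right.2 fun h : t < t => lt_irrefl t h)
  have h2 : Indep (⨆ i ∈ insert (Sum.inr (Sum.inl t)) (pastIndex t), ξ.source i)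
      (⨆ i ∈ ({Sum.inr (Sum.inr t)} : Set _), ξ.source i) P :=
    indep_iSup_of_disjoint ξ.source_le ξ.indep (Set.disjoint_singleton_right.2 fun h => by
      rcases h with h | h
      · simp at h
      · exact lt_irrefl t h)
  rw [iSup_insert, iSup_singleton] at h2
  rw [iSup_singleton] at h1
  have e2 := (Indep_iff _ _ _).1 h2 (E ∩ ξ.w t ⁻¹' A) (ξ.η t ⁻¹' B)
    (MeasurableSet.inter (le_sup_right (a := ξ.source (Sum.inr (Sum.inl t))) (b := ξ.past t) _ hE)
      (le_sup_left (a := ξ.source (Sum.inr (Sum.inl t))) (b := ξ.past t) _ hwA)) hηB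
  have e1 := (Indep_iff _ _ _).1 h1 E (ξ.w t ⁻¹' A) hE hwA
  rw [measureReal_def, e2, e1, ENNReal.toReal_mul, ENNReal.toReal_mul,
    ← Measure.map_apply (ξ.measurable_w t) hA, ξ.map_w]
  rfl

theorem measurable_η_mem (t : ℕ) (B : Set Bool) : MeasurableSet (ξ.η t ⁻¹' B) :=
  ξ.measurable_η t trivial

variable [MeasurableSingletonClass S]

/-! ### Measurability of the processes -/

/-- The target carries `⊤`, which is harmless on a finite type and makes every function of the state
measurable. -/
theorem measurable_state (t : ℕ) : @Measurable _ _ (ξ.past t) ⊤ (ξ.state t) := by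
  induction t with
  | zero =>
    intro A _
    exact ξ.measurable_s₀_past (A.toFinite.measurableSet)
  | succ t ih =>
    intro A _
    -- Splitting by the previous state leaves, in each piece, a condition on `w t` alone.
    have : ξ.state (t + 1) ⁻¹' A =
        ⋃ s, ξ.state t ⁻¹' {s} ∩ ξ.w t ⁻¹' {w | D.step s w ∈ A} := by
      ext ω; simp [state]
    rw [this]
    exact MeasurableSet.iUnion fun s => MeasurableSet.inter
      (ξ.past_le_succ t _ (ih (show MeasurableSet[⊤] {s} from trivial)))
      (ξ.measurable_w_past t (D.measurableSet_step_mem s A))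

theorem measurableSet_state_past (t : ℕ) (s : Fin n → S) :
    MeasurableSet[ξ.past t] (ξ.state t ⁻¹' {s}) :=
  ξ.measurable_state t (show MeasurableSet[⊤] {s} from trivial)

theorem measurable_data (t : ℕ) : @Measurable _ _ (ξ.past t) ⊤ (ξ.data t) :=
  (@measurable_from_top _ _ ⊤ empirical).comp (ξ.measurable_state t)

theorem measurable_info (g : Strategy S n) (t : ℕ) :
    @Measurable _ _ (ξ.past t) ⊤ (ξ.info g t) := by
  induction t with
  | zero =>
    exact (@measurable_from_top _ _ ⊤ fun m : EmpDist S n =>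
      ((fun _ => some m, Fin.elim0) : Info S n 0)).comp (ξ.measurable_data 0)
  | succ t ih =>
    have h1 : @Measurable _ _ (ξ.past (t + 1)) ⊤ (ξ.info g t) :=
      fun A hA => ξ.past_le_succ t _ (ih hA)
    have h2 : @Measurable _ _ (ξ.past (t + 1)) ⊤ (ξ.η t) := ξ.measurable_η_past t
    have h := measurable_top_prodMk h1 (measurable_top_prodMk h2 (ξ.measurable_data (t + 1)))
    exact (@measurable_from_top _ _ ⊤ fun x : Info S n t × Bool × EmpDist S n =>
      ((Fin.snoc (α := fun _ => Obs S n) x.1.1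
        (if g t x.1 = true ∧ x.2.1 = true then some x.2.2 else none),
        Fin.snoc (α := fun _ => Bool) x.1.2 (g t x.1)) : Info S n (t + 1))).comp h

theorem measurableSet_infoEvent_past (g : Strategy S n) {t : ℕ} (H : Info S n t) :
    MeasurableSet[ξ.past t] (ξ.infoEvent g H) :=
  ξ.measurable_info g t (show MeasurableSet[⊤] {H} from trivial)

theorem measurableSet_infoEvent (g : Strategy S n) {t : ℕ} (H : Info S n t) :
    MeasurableSet (ξ.infoEvent g H) :=
  ξ.past_le t _ (ξ.measurableSet_infoEvent_past g H)

theorem measurableSet_data_past (t : ℕ) (m : EmpDist S n) :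
    MeasurableSet[ξ.past t] {ω | ξ.data t ω = m} :=
  ξ.measurable_data t (show MeasurableSet[⊤] {m} from trivial)

theorem measurableSet_data (t : ℕ) (m : EmpDist S n) : MeasurableSet {ω | ξ.data t ω = m} :=
  ξ.past_le t _ (ξ.measurableSet_data_past t m)

/-! ### Transition probabilities -/

theorem real_past_inter_state_transition (hexch : D.Exchangeable) {t : ℕ} {E : Set Ω}
    (hE : MeasurableSet[ξ.past t] E) (s : Fin n → S) (m' : EmpDist S n) (B : Set Bool) :
    P.real (E ∩ ξ.state t ⁻¹' {s} ∩ {ω | ξ.data (t + 1) ω = m'} ∩ ξ.η t ⁻¹' B) =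
      P.real (E ∩ ξ.state t ⁻¹' {s}) * D.Tm m' (empirical s) * P.real (ξ.η t ⁻¹' B) := by
  have h := ξ.real_past_inter_transition
    (MeasurableSet.inter hE (ξ.measurableSet_state_past t s))
    (D.measurableSet_step_mem s {r | empirical r = m'}) B
  have e : E ∩ ξ.state t ⁻¹' {s} ∩ {ω | ξ.data (t + 1) ω = m'} =
      E ∩ ξ.state t ⁻¹' {s} ∩ ξ.w t ⁻¹' {w | D.step s w ∈ {r | empirical r = m'}} := by
    ext ω
    simp only [Set.mem_inter_iff, Set.mem_preimage, Set.mem_singleton_iff, Set.mem_ofPred_eq, data,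
      state, and_congr_right_iff]
    rintro ⟨-, rfl⟩
    rfl
  rw [e, h, ← D.real_step_eq_Tm hexch]
  rfl

variable [IsProbabilityMeasure P]

/-- The Markov property of the data, relative to the whole past and jointly with `η t`: sum over the
configurations with empirical distribution `m`, all of which have the same transition probability.
-/
theorem real_past_inter_data_transition (hexch : D.Exchangeable) {t : ℕ} {E : Set Ω}
    (hE : MeasurableSet[ξ.past t] E) (m m' : EmpDist S n) (B : Set Bool) :
    P.real (E ∩ {ω | ξ.data t ω = m} ∩ {ω | ξ.data (t + 1) ω = m'} ∩ ξ.η t ⁻¹' B) =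
      P.real (E ∩ {ω | ξ.data t ω = m}) * D.Tm m' m * P.real (ξ.η t ⁻¹' B) := by
  have hd : ∀ F : Set Ω, MeasurableSet F → P.real (E ∩ {ω | ξ.data t ω = m} ∩ F) =
      ∑ s : Fin n → S with empirical s = m, P.real (E ∩ ξ.state t ⁻¹' {s} ∩ F) := by
    intro F hF
    have : E ∩ {ω | ξ.data t ω = m} ∩ F =
        ⋃ s ∈ Finset.univ.filter fun s : Fin n → S => empirical s = m,
          E ∩ ξ.state t ⁻¹' {s} ∩ F := by
      ext ω
      simp only [data, Set.mem_inter_iff, Set.mem_ofPred_eq, Finset.mem_filter, Finset.mem_univ,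
        true_and, Set.mem_iUnion, Set.mem_preimage, Set.mem_singleton_iff, exists_prop]
      constructor
      · rintro ⟨⟨h1, h2⟩, h3⟩
        exact ⟨_, h2, ⟨h1, rfl⟩, h3⟩
      · rintro ⟨_, h2, ⟨h1, rfl⟩, h3⟩
        exact ⟨⟨h1, h2⟩, h3⟩
    rw [this, measureReal_biUnion_finset]
    · intro s _ s' _ hs
      exact Set.disjoint_left.2 fun ω h h' => hs (h.1.2.symm.trans h'.1.2)
    · intro s _
      exact ((ξ.past_le t _ hE).inter
        (ξ.past_le t _ (ξ.measurableSet_state_past t s))).inter hF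
  rw [Set.inter_assoc, hd _ ((ξ.measurableSet_data _ _).inter (ξ.measurable_η_mem t B)),
    ← Set.inter_univ (E ∩ {ω | ξ.data t ω = m}), hd _ MeasurableSet.univ, Finset.sum_mul,
    Finset.sum_mul]
  refine Finset.sum_congr rfl fun s hs => ?_
  rw [← Set.inter_assoc, ξ.real_past_inter_state_transition hexch hE, Set.inter_univ,
    (Finset.mem_filter.1 hs).2]

theorem real_eq_sum_data (t : ℕ) {E : Set Ω} (hE : MeasurableSet E) :
    P.real E = ∑ m, P.real (E ∩ {ω | ξ.data t ω = m}) := by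
  rw [← measureReal_biUnion_finset]
  · congr 1
    ext ω
    simp
  · intro s _ s' _ hs
    exact Set.disjoint_left.2 fun ω h h' => hs (h.2.symm.trans h'.2)
  · intro m _
    exact hE.inter (ξ.measurableSet_data t m)

theorem real_past_inter_next (hexch : D.Exchangeable) {t : ℕ} {E : Set Ω}
    (hE : MeasurableSet[ξ.past t] E) (m' : EmpDist S n) (B : Set Bool) :
    P.real (E ∩ ξ.η t ⁻¹' B ∩ {ω | ξ.data (t + 1) ω = m'}) =
      (∑ m, D.Tm m' m * P.real (E ∩ {ω | ξ.data t ω = m})) * P.real (ξ.η t ⁻¹' B) := by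
  rw [ξ.real_eq_sum_data t (((ξ.past_le t _ hE).inter (ξ.measurable_η_mem t B)).inter
    (ξ.measurableSet_data _ _)), Finset.sum_mul]
  refine Finset.sum_congr rfl fun m _ => ?_
  have : E ∩ ξ.η t ⁻¹' B ∩ {ω | ξ.data (t + 1) ω = m'} ∩ {ω | ξ.data t ω = m} =
      E ∩ {ω | ξ.data t ω = m} ∩ {ω | ξ.data (t + 1) ω = m'} ∩ ξ.η t ⁻¹' B := by
    ext ω; simp only [Set.mem_inter_iff]; tauto
  rw [this, ξ.real_past_inter_data_transition hexch hE]
  ring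

theorem real_past_inter_η {t : ℕ} {E : Set Ω} (hE : MeasurableSet[ξ.past t] E) (B : Set Bool) :
    P.real (E ∩ ξ.η t ⁻¹' B) = P.real E * P.real (ξ.η t ⁻¹' B) := by
  have := D.isProbabilityMeasure_Pw
  simpa using ξ.real_past_inter_transition hE MeasurableSet.univ B

theorem cond_real_data_succ (hexch : D.Exchangeable) {t : ℕ} {m : EmpDist S n}
    (h : P {ω | ξ.data t ω = m} ≠ 0) (m' : EmpDist S n) :
    (cond P {ω | ξ.data t ω = m}).real {ω | ξ.data (t + 1) ω = m'} = D.Tm m' m := by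
  have := ξ.real_past_inter_data_transition hexch (t := t) (E := Set.univ)
    (@MeasurableSet.univ _ (ξ.past t)) m m' Set.univ
  simp only [Set.univ_inter, Set.preimage_univ, Set.inter_univ, probReal_univ, mul_one] at this
  exact (cond_real_eq_iff (ξ.measurableSet_data t m) h _ _).2 this

end DataModel.Primitives

/-- The information at the previous time. -/
def Info.init {S : Type*} [Fintype S] {n t : ℕ} (H : Info S n (t + 1)) : Info S n t :=
  (fun i => H.1 i.castSucc, fun i => H.2 i.castSucc)

namespace DataModel.Primitives

variable {S W Ω : Type*} [Fintype S] [DecidableEq S] [MeasurableSpace S] [MeasurableSpace W]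
  {n : ℕ} [NeZero n] {D : DataModel S W n} [MeasurableSpace Ω] {P : Measure Ω}
  (ξ : D.Primitives P)

/-! ### The information process -/

theorem obs_succ (g : Strategy S n) (t : ℕ) (ω : Ω) :
    ξ.obs g (t + 1) ω =
      if g t (ξ.info g t ω) = true ∧ ξ.η t ω = true then some (ξ.data (t + 1) ω) else none := by
  simp only [obs, info]
  rw [Fin.snoc_last]

theorem info_succ (g : Strategy S n) (t : ℕ) (ω : Ω) :
    ξ.info g (t + 1) ω =
      (Fin.snoc (α := fun _ => Obs S n) (ξ.info g t ω).1 (ξ.obs g (t + 1) ω),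
        Fin.snoc (α := fun _ => Bool) (ξ.info g t ω).2 (g t (ξ.info g t ω))) := by
  rw [obs_succ]
  rfl

theorem init_info_succ (g : Strategy S n) (t : ℕ) (ω : Ω) :
    (ξ.info g (t + 1) ω).init = ξ.info g t ω := by
  simp [info_succ, Info.init]

/-- If the last action of `H` is not the one that `g` prescribes, the event is empty; otherwise the
action component is automatic and only the new observation adds a condition. -/
theorem infoEvent_succ (g : Strategy S n) {t : ℕ} (H : Info S n (t + 1)) :
    ξ.infoEvent g H = ∅ ∨ ξ.infoEvent g H =
      ξ.infoEvent g H.init ∩ {ω | ξ.obs g (t + 1) ω = H.1 (Fin.last (t + 1))} := by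
  rw [or_iff_not_imp_left, ← Ne, ← Set.nonempty_iff_ne_empty]
  rintro ⟨ω₀, h₀⟩
  have ha : H.2 (Fin.last t) = g t H.init := by
    have h₀ : ξ.info g (t + 1) ω₀ = H := h₀
    rw [← h₀, init_info_succ, info_succ]
    exact Fin.snoc_last (α := fun _ => Bool) _ _
  ext ω
  constructor
  · rintro rfl
    exact ⟨(ξ.init_info_succ g t ω).symm, rfl⟩
  · rintro ⟨h1 : ξ.info g t ω = H.init, h2 : ξ.obs g (t + 1) ω = _⟩
    change ξ.info g (t + 1) ω = H
    rw [info_succ, h2, h1, ← ha]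
    exact Prod.ext (Fin.snoc_init_self H.1) (Fin.snoc_init_self H.2)

theorem stat_eq_fHat [Nonempty S] {t : ℕ} (H : Info S n (t + 1)) :
    stat H = fHat (stat H.init) (H.1 (Fin.last (t + 1))) := by
  have := stat_snoc H.init.1 H.init.2 H.2 (H.1 (Fin.last (t + 1)))
  rw [show Fin.snoc (α := fun _ => Obs S n) H.init.1 (H.1 (Fin.last (t + 1))) = H.1 from
    Fin.snoc_init_self H.1] at this
  exact this

theorem stat_info_zero [Nonempty S] (g : Strategy S n) (ω : Ω) :
    stat (ξ.info g 0 ω) = (ξ.data 0 ω, 0) := stat_zero_some _ rfl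

theorem stat_info_succ [Nonempty S] (g : Strategy S n) (t : ℕ) (ω : Ω) :
    stat (ξ.info g (t + 1) ω) = fHat (stat (ξ.info g t ω)) (ξ.obs g (t + 1) ω) := by
  rw [stat_eq_fHat, init_info_succ]
  rfl

theorem infoEvent_inter_obs_none (g : Strategy S n) {t : ℕ} (H : Info S n t) :
    ξ.infoEvent g H ∩ {ω | ξ.obs g (t + 1) ω = none} =
      ξ.infoEvent g H ∩ ξ.η t ⁻¹' {b | g t H = true ∧ b = true}ᶜ := by
  ext ω
  refine and_congr_right fun h : ξ.info g t ω = H => ?_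
  simp [obs_succ, h]

theorem infoEvent_inter_obs_some (g : Strategy S n) {t : ℕ} (H : Info S n t) (m : EmpDist S n) :
    ξ.infoEvent g H ∩ {ω | ξ.obs g (t + 1) ω = some m} =
      ξ.infoEvent g H ∩ ξ.η t ⁻¹' {b | g t H = true ∧ b = true} ∩
        {ω | ξ.data (t + 1) ω = m} := by
  ext ω
  rw [Set.inter_assoc]
  refine and_congr_right fun h : ξ.info g t ω = H => ?_
  simp [obs_succ, h]

theorem real_η_and (a : Bool) (t : ℕ) :
    P.real (ξ.η t ⁻¹' {b | a = true ∧ b = true}) = a.toNat * D.q := by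
  cases a
  · simp
  · simpa [Set.preimage] using ξ.prob_η t

variable [IsProbabilityMeasure P]

theorem real_η_and_compl (a : Bool) (t : ℕ) :
    P.real (ξ.η t ⁻¹' {b | a = true ∧ b = true}ᶜ) = 1 - a.toNat * D.q := by
  rw [Set.preimage_compl, probReal_compl_eq_one_sub (ξ.measurable_η_mem t _), real_η_and]

variable [Nonempty S] [MeasurableSingletonClass S]

/-! ### Conditional laws given the information -/

theorem real_inter_data_of_subset {t : ℕ} {E : Set Ω} {x : EmpDist S n}
    (h : E ⊆ {ω | ξ.data t ω = x}) (m : EmpDist S n) :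
    P.real (E ∩ {ω | ξ.data t ω = m}) = P.real E * (D.Tm ^ 0) m x := by
  rw [pow_zero, Matrix.one_apply]
  split_ifs with hm
  · rw [hm, Set.inter_eq_left.2 h, mul_one]
  · have : E ∩ {ω | ξ.data t ω = m} = ∅ :=
      Set.eq_empty_of_forall_notMem fun ω hω => hm (hω.2.symm.trans (h hω.1))
    rw [this, measureReal_empty, mul_zero]

/-- The filter in unnormalized form, so that the induction also passes through histories of
probability zero. -/
theorem real_infoEvent_inter_data (hexch : D.Exchangeable) (g : Strategy S n) {t : ℕ}
    (H : Info S n t) (m : EmpDist S n) :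
    P.real (ξ.infoEvent g H ∩ {ω | ξ.data t ω = m}) =
      P.real (ξ.infoEvent g H) * (D.Tm ^ (stat H).2) m (stat H).1 := by
  induction t generalizing m with
  | zero =>
    rcases (ξ.infoEvent g H).eq_empty_or_nonempty with h | ⟨ω₀, rfl⟩
    · simp [h]
    · rw [stat_info_zero]
      refine ξ.real_inter_data_of_subset (fun ω hω => ?_) m
      have : ξ.info g 0 ω = ξ.info g 0 ω₀ := hω
      simpa [info] using congrFun (congrArg Prod.fst this) 0
  | succ t ih =>
    rcases ξ.infoEvent_succ g H with h | h
    · simp [h]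
    · rw [stat_eq_fHat]
      cases ho : H.1 (Fin.last (t + 1)) with
      -- Credible data: the event lies in `{data = x}`, so the law is a point mass, the power `0` of
      -- `Tm`.
      | some x =>
        rw [ho, infoEvent_inter_obs_some] at h
        exact ξ.real_inter_data_of_subset (h ▸ Set.inter_subset_right) m
      -- A blank restricts the previous history only through `η t`; its probability factors out and
      -- one transition is applied.
      | none =>
        rw [ho, infoEvent_inter_obs_none] at h
        have hp := ξ.measurableSet_infoEvent_past g H.init
        rw [h, ξ.real_past_inter_next hexch hp, ξ.real_past_inter_η hp]
        simp only [ih, fHat, pow_succ', Matrix.mul_apply]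
        rw [Finset.mul_sum, Finset.sum_mul]
        exact Finset.sum_congr rfl fun _ _ => by ring

theorem real_infoEvent_inter_obs (hexch : D.Exchangeable) (g : Strategy S n) {t : ℕ}
    (H : Info S n t) (o : Obs S n) :
    P.real (ξ.infoEvent g H ∩ {ω | ξ.obs g (t + 1) ω = o}) =
      P.real (ξ.infoEvent g H) * D.obsLaw (stat H) (g t H) o := by
  have hp := ξ.measurableSet_infoEvent_past g H
  cases o with
  | none => rw [infoEvent_inter_obs_none, ξ.real_past_inter_η hp, real_η_and_compl]; rfl
  | some m =>
    rw [infoEvent_inter_obs_some, ξ.real_past_inter_next hexch hp, real_η_and]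
    simp only [ξ.real_infoEvent_inter_data hexch, obsLaw, pow_succ', Matrix.mul_apply]
    rw [Finset.sum_mul, Finset.mul_sum, Finset.mul_sum]
    exact Finset.sum_congr rfl fun _ _ => by ring

theorem belief_eq (hexch : D.Exchangeable) (g : Strategy S n) {t : ℕ}
    {H : Info S n t} (h : P (ξ.infoEvent g H) ≠ 0) (m : EmpDist S n) :
    ξ.belief g H m = (D.Tm ^ (stat H).2) m (stat H).1 :=
  (cond_real_eq_iff (ξ.measurableSet_infoEvent g H) h _ _).2
    (ξ.real_infoEvent_inter_data hexch g H m)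

theorem infoActionEvent_eq (g : Strategy S n) {t : ℕ} {H : Info S n t} {a : Bool}
    (h : P (ξ.infoActionEvent g H a) ≠ 0) :
    a = g t H ∧ ξ.infoActionEvent g H a = ξ.infoEvent g H := by
  obtain ⟨ω₀, h₀ : ξ.info g t ω₀ = H, rfl⟩ := nonempty_of_measure_ne_zero h
  refine ⟨by rw [action, h₀], Set.ext fun ω => ⟨fun hω => hω.1, fun hω => ⟨hω, ?_⟩⟩⟩
  have hω : ξ.info g t ω = H := hω
  rw [action, action, h₀, hω]

/-! ### Costs -/

theorem cost_nonneg (g : Strategy S n) (t : ℕ) (ω : Ω) : 0 ≤ ξ.cost g t ω := D.c_nonneg _ _ _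

theorem measurable_cost (g : Strategy S n) (t : ℕ) : Measurable (ξ.cost g t) := by
  have h := measurable_top_prodMk (ξ.measurable_data t) (ξ.measurable_info g t)
  have h' : @Measurable _ _ (ξ.past t) _ (ξ.cost g t) :=
    (@measurable_from_top _ _ _ fun x : EmpDist S n × Info S n t =>
      D.c x.1 (D.h (ξ.belief g x.2)) (g t x.2)).comp h
  exact h'.mono (ξ.past_le t) le_rfl

theorem summable_cost (g : Strategy S n) (t : ℕ) (ω : Ω) :
    Summable fun k : ℕ => D.γ ^ k * ξ.cost g (t + k) ω := by
  obtain ⟨C, -, hC⟩ := D.exists_cost_bound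
  exact Summable.of_nonneg_of_le
    (fun k => mul_nonneg (pow_nonneg D.γ_mem.1.le _) (ξ.cost_nonneg g _ ω))
    (fun k => mul_le_mul_of_nonneg_left (hC _ _ _) (pow_nonneg D.γ_mem.1.le _))
    ((summable_geometric_of_lt_one D.γ_mem.1.le D.γ_mem.2).mul_right C)

theorem exists_abs_tailCost_le (g : Strategy S n) : ∃ K, ∀ t ω, |ξ.tailCost g t ω| ≤ K := by
  obtain ⟨C, -, hC⟩ := D.exists_cost_bound
  refine ⟨∑' k : ℕ, D.γ ^ k * C, fun t ω => ?_⟩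
  rw [tailCost, abs_of_nonneg (tsum_nonneg fun k =>
    mul_nonneg (pow_nonneg D.γ_mem.1.le _) (ξ.cost_nonneg g _ ω))]
  exact (ξ.summable_cost g t ω).tsum_le_tsum
    (fun k => mul_le_mul_of_nonneg_left (hC _ _ _) (pow_nonneg D.γ_mem.1.le _))
    ((summable_geometric_of_lt_one D.γ_mem.1.le D.γ_mem.2).mul_right C)

theorem integrable_cost (g : Strategy S n) (t : ℕ) : Integrable (ξ.cost g t) P := by
  obtain ⟨C, -, hC⟩ := D.exists_cost_bound
  refine Integrable.of_bound (ξ.measurable_cost g t).aestronglyMeasurable C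
    (Filter.Eventually.of_forall fun ω => ?_)
  rw [Real.norm_of_nonneg (ξ.cost_nonneg g t ω)]
  exact hC _ _ _

theorem integrable_tailCost (g : Strategy S n) (t : ℕ) : Integrable (ξ.tailCost g t) P := by
  obtain ⟨K, hK⟩ := ξ.exists_abs_tailCost_le g
  have hm : Measurable (ξ.tailCost g t) := by
    refine measurable_of_tendsto_metrizable
      (f := fun N ω => ∑ k ∈ Finset.range N, D.γ ^ k * ξ.cost g (t + k) ω) (fun N => ?_)
      (tendsto_pi_nhds.2 fun ω => (ξ.summable_cost g t ω).hasSum.tendsto_sum_nat)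
    exact Finset.measurable_sum _ fun k _ => (ξ.measurable_cost g _).const_mul _
  exact Integrable.of_bound hm.aestronglyMeasurable K (Filter.Eventually.of_forall (hK t))

theorem tailCost_eq (g : Strategy S n) (t : ℕ) (ω : Ω) :
    ξ.tailCost g t ω = ξ.cost g t ω + D.γ * ξ.tailCost g (t + 1) ω := by
  rw [tailCost, (ξ.summable_cost g t ω).tsum_eq_zero_add, tailCost, ← tsum_mul_left]
  congr 1
  · simp
  · refine tsum_congr fun k => ?_
    rw [pow_succ', mul_assoc, show t + (k + 1) = t + 1 + k by ring]

theorem setIntegral_cost (hexch : D.Exchangeable) (g : Strategy S n) {t : ℕ} (H : Info S n t) :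
    ∫ ω in ξ.infoEvent g H, ξ.cost g t ω ∂P =
      P.real (ξ.infoEvent g H) * D.cHat (stat H) (g t H) := by
  -- The estimate is computed from a conditional law, which is known only on histories of positive
  -- probability; on the others both sides vanish.
  by_cases h : P (ξ.infoEvent g H) = 0
  · rw [setIntegral_measure_zero _ h, measureReal_def, h]
    simp
  have hE := ξ.measurableSet_infoEvent g H
  rw [setIntegral_eq_sum_fibers hE (ξ.measurableSet_data t) (ξ.integrable_cost g t), cHat,
    Finset.mul_sum]
  refine Finset.sum_congr rfl fun m _ => ?_
  rw [setIntegral_eq_real_mul (hE.inter (ξ.measurableSet_data t m))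
    (r := D.c m (D.h fun m' => (D.Tm ^ (stat H).2) m' (stat H).1) (g t H)),
    ξ.real_infoEvent_inter_data hexch]
  · ring
  · rintro ω ⟨h1 : ξ.info g t ω = H, h2 : ξ.data t ω = m⟩
    rw [cost, estimate, action, h1, h2, funext (ξ.belief_eq hexch g h)]

/-! ### Dynamic programming -/

theorem measurableSet_obs (g : Strategy S n) (t : ℕ) (o : Obs S n) :
    MeasurableSet {ω | ξ.obs g t ω = o} :=
  ξ.past_le t _ (ξ.measurable_info g t
    (show MeasurableSet[⊤] {H : Info S n t | H.1 (Fin.last t) = o} from trivial))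

theorem integrable_stat (g : Strategy S n) (t : ℕ) {V : EmpDist S n × ℕ → ℝ}
    (hV : ∃ C, ∀ p, |V p| ≤ C) : Integrable (fun ω => V (stat (ξ.info g t ω))) P := by
  obtain ⟨C, hC⟩ := hV
  have h' : @Measurable _ _ (ξ.past t) _ fun ω => V (stat (ξ.info g t ω)) :=
    (@measurable_from_top _ _ _ fun H : Info S n t => V (stat H)).comp (ξ.measurable_info g t)
  exact Integrable.of_bound (h'.mono (ξ.past_le t) le_rfl).aestronglyMeasurable C
    (Filter.Eventually.of_forall fun ω => hC _)

/-- Identifies `qValue` as the mean of the current cost plus the discounted value one step later: on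
the history event, the next pair depends only on the next observation. -/
theorem setIntegral_cost_add_stat_succ (hexch : D.Exchangeable) (g : Strategy S n) {t : ℕ}
    (H : Info S n t) {V : EmpDist S n × ℕ → ℝ} (hV : ∃ C, ∀ p, |V p| ≤ C) :
    ∫ ω in ξ.infoEvent g H, (ξ.cost g t ω + D.γ * V (stat (ξ.info g (t + 1) ω))) ∂P =
      P.real (ξ.infoEvent g H) * D.qValue V (stat H) (g t H) := by
  have hE := ξ.measurableSet_infoEvent g H
  have hi := ξ.integrable_stat g (t + 1) hV
  rw [integral_add (ξ.integrable_cost g t).integrableOn (hi.const_mul _).integrableOn,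
    ξ.setIntegral_cost hexch, integral_const_mul,
    setIntegral_eq_sum_fibers hE (ξ.measurableSet_obs g (t + 1)) hi, qValue, mul_add,
    mul_left_comm (P.real _) D.γ, Finset.mul_sum (a := P.real _)]
  congr 2
  refine Finset.sum_congr rfl fun o _ => ?_
  rw [setIntegral_eq_real_mul (hE.inter (ξ.measurableSet_obs g (t + 1) o))
    (r := V (fHat (stat H) o)), ξ.real_infoEvent_inter_obs hexch, mul_assoc]
  rintro ω ⟨h1 : ξ.info g t ω = H, h2 : ξ.obs g (t + 1) ω = o⟩
  rw [stat_info_succ, h1, h2]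

theorem setIntegral_eq_sum_info (g : Strategy S n) (t : ℕ) {E : Set Ω} (hE : MeasurableSet E)
    {φ : Ω → ℝ} (hφ : Integrable φ P) :
    ∫ ω in E, φ ω ∂P = ∑ H : Info S n t, ∫ ω in E ∩ ξ.infoEvent g H, φ ω ∂P :=
  setIntegral_eq_sum_fibers hE (fun H => ξ.measurableSet_infoEvent g H) hφ

theorem infoEvent_inter_infoEvent_succ (g : Strategy S n) {t : ℕ} (H : Info S n t)
    (H' : Info S n (t + 1)) :
    ξ.infoEvent g H ∩ ξ.infoEvent g H' = if H'.init = H then ξ.infoEvent g H' else ∅ := by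
  split_ifs with h
  · refine Set.inter_eq_right.2 fun ω (hω : ξ.info g (t + 1) ω = H') => ?_
    change ξ.info g t ω = H
    rw [← h, ← hω, init_info_succ]
  · refine Set.eq_empty_of_forall_notMem ?_
    rintro ω ⟨h1 : ξ.info g t ω = H, h2 : ξ.info g (t + 1) ω = H'⟩
    exact h (by rw [← h1, ← h2, init_info_succ])

/-- A bounded process whose mean on the information events is dominated by the discounted mean of
its next value has nonpositive means. -/
theorem setIntegral_nonpos_of_le_discounted (g : Strategy S n) (t₀ : ℕ) (Z : ℕ → Ω → ℝ)
    (hZ : ∀ t, Integrable (Z t) P) (hb : ∃ K, ∀ t ω, |Z t ω| ≤ K)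
    (h : ∀ t, t₀ ≤ t → ∀ H : Info S n t,
      ∫ ω in ξ.infoEvent g H, Z t ω ∂P ≤ D.γ * ∫ ω in ξ.infoEvent g H, Z (t + 1) ω ∂P)
    (H : Info S n t₀) : ∫ ω in ξ.infoEvent g H, Z t₀ ω ∂P ≤ 0 := by
  obtain ⟨K, hK⟩ := hb
  -- The start `t` and the history vary in the induction on `N`, since one step leads to longer
  -- histories at time `t + 1`.
  have key : ∀ (N t : ℕ), t₀ ≤ t → ∀ H : Info S n t,
      ∫ ω in ξ.infoEvent g H, Z t ω ∂P ≤ D.γ ^ N * K * P.real (ξ.infoEvent g H) := by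
    intro N
    induction N with
    | zero =>
      intro t _ H
      rw [pow_zero, one_mul]
      refine (le_abs_self _).trans ?_
      rw [← Real.norm_eq_abs]
      exact norm_setIntegral_le_of_norm_le_const (measure_lt_top _ _) fun ω _ => hK t ω
    | succ N ih =>
      intro t ht H
      refine (h t ht H).trans ?_
      rw [pow_succ', mul_assoc, mul_assoc]
      refine mul_le_mul_of_nonneg_left ?_ D.γ_mem.1.le
      have hE := ξ.measurableSet_infoEvent g H
      have h1 : P.real (ξ.infoEvent g H) =
          ∑ H' : Info S n (t + 1), P.real (ξ.infoEvent g H ∩ ξ.infoEvent g H') := by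
        have := ξ.setIntegral_eq_sum_info g (t + 1) hE (integrable_const (μ := P) (1 : ℝ))
        simpa using this
      rw [ξ.setIntegral_eq_sum_info g (t + 1) hE (hZ _), h1, Finset.mul_sum, Finset.mul_sum]
      refine Finset.sum_le_sum fun H' _ => ?_
      -- Only the continuations of `H` contribute; every other intersection is empty.
      rw [infoEvent_inter_infoEvent_succ]
      split_ifs
      · rw [← mul_assoc]
        exact ih (t + 1) (ht.trans (Nat.le_succ t)) H'
      · simp
  have hlim : Filter.Tendsto (fun N : ℕ => D.γ ^ N * K * P.real (ξ.infoEvent g H)) Filter.atTop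
      (nhds 0) := by
    simpa using (((tendsto_pow_atTop_nhds_zero_of_lt_one D.γ_mem.1.le D.γ_mem.2).mul_const
      K).mul_const (P.real (ξ.infoEvent g H)))
  exact ge_of_tendsto hlim (Filter.Eventually.of_forall fun N => key N t₀ le_rfl H)

/-- Adding and subtracting the one-step mean `qValue` cancels the current cost and leaves the
Bellman gap plus the discounted error one step later. -/
theorem setIntegral_stat_sub_tailCost (hexch : D.Exchangeable) (g : Strategy S n) {t : ℕ}
    (H : Info S n t) {V : EmpDist S n × ℕ → ℝ} (hV : ∃ C, ∀ p, |V p| ≤ C) :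
    ∫ ω in ξ.infoEvent g H, (V (stat (ξ.info g t ω)) - ξ.tailCost g t ω) ∂P =
      P.real (ξ.infoEvent g H) * (V (stat H) - D.qValue V (stat H) (g t H)) +
      D.γ * ∫ ω in ξ.infoEvent g H,
        (V (stat (ξ.info g (t + 1) ω)) - ξ.tailCost g (t + 1) ω) ∂P := by
  have hE := ξ.measurableSet_infoEvent g H
  have e1 : ∫ ω in ξ.infoEvent g H, V (stat (ξ.info g t ω)) ∂P =
      P.real (ξ.infoEvent g H) * V (stat H) :=
    setIntegral_eq_real_mul hE fun ω hω => by
      rw [show ξ.info g t ω = H from hω]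
  have i1 := (ξ.integrable_stat g t hV).integrableOn (s := ξ.infoEvent g H)
  have i2 := (ξ.integrable_stat g (t + 1) hV).integrableOn (s := ξ.infoEvent g H)
  have i3 := (ξ.integrable_cost g t).integrableOn (s := ξ.infoEvent g H)
  have i4 := (ξ.integrable_tailCost g (t + 1)).integrableOn (s := ξ.infoEvent g H)
  have e2 := ξ.setIntegral_cost_add_stat_succ hexch g H hV
  rw [integral_add i3 (i2.const_mul _), integral_const_mul] at e2
  rw [integral_sub i1 (ξ.integrable_tailCost g t).integrableOn, integral_sub i2 i4, e1]
  simp only [ξ.tailCost_eq g t]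
  rw [integral_add i3 (i4.const_mul _), integral_const_mul, mul_sub, ← e2]
  ring

theorem real_mul_le_setIntegral_tailCost (hexch : D.Exchangeable) {V : EmpDist S n × ℕ → ℝ}
    (hb : ∃ C, ∀ p, |V p| ≤ C) (hV : D.IsBellman V) (g : Strategy S n) {t : ℕ}
    (H : Info S n t) :
    P.real (ξ.infoEvent g H) * V (stat H) ≤ ∫ ω in ξ.infoEvent g H, ξ.tailCost g t ω ∂P := by
  obtain ⟨C, hC⟩ := hb
  obtain ⟨K, hK⟩ := ξ.exists_abs_tailCost_le g
  have h := ξ.setIntegral_nonpos_of_le_discounted g t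
    (fun k ω => V (stat (ξ.info g k ω)) - ξ.tailCost g k ω)
    (fun k => (ξ.integrable_stat g k ⟨C, hC⟩).sub (ξ.integrable_tailCost g k))
    ⟨C + K, fun k ω => (abs_sub _ _).trans (add_le_add (hC _) (hK _ _))⟩
    (fun k _ H' => by
      rw [ξ.setIntegral_stat_sub_tailCost hexch g H' ⟨C, hC⟩]
      exact add_le_of_nonpos_left (mul_nonpos_of_nonneg_of_nonpos measureReal_nonneg
        (sub_nonpos.2 (hV.le_qValue _ _)))) H
  rw [integral_sub (ξ.integrable_stat g t ⟨C, hC⟩).integrableOn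
    (ξ.integrable_tailCost g t).integrableOn,
    setIntegral_eq_real_mul (ξ.measurableSet_infoEvent g H) (r := V (stat H))
      fun ω hω => by rw [show ξ.info g t ω = H from hω]] at h
  exact sub_nonpos.1 h

theorem setIntegral_tailCost_of_isGreedy (hexch : D.Exchangeable) {V : EmpDist S n × ℕ → ℝ}
    (hb : ∃ C, ∀ p, |V p| ≤ C) (hV : D.IsBellman V) (g : Strategy S n) {t : ℕ}
    (H : Info S n t)
    (hg : ∀ k : ℕ, t ≤ k → ∀ H' : Info S n k, D.IsGreedy V (stat H') (g k H')) :
    ∫ ω in ξ.infoEvent g H, ξ.tailCost g t ω ∂P = P.real (ξ.infoEvent g H) * V (stat H) := by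
  refine le_antisymm ?_ (ξ.real_mul_le_setIntegral_tailCost hexch hb hV g H)
  obtain ⟨C, hC⟩ := hb
  obtain ⟨K, hK⟩ := ξ.exists_abs_tailCost_le g
  -- For minimizing actions the gap vanishes from time `t` on, so the recursion is an equality and
  -- also applies to the negated difference.
  have h := ξ.setIntegral_nonpos_of_le_discounted g t
    (fun k ω => -(V (stat (ξ.info g k ω)) - ξ.tailCost g k ω))
    (fun k => ((ξ.integrable_stat g k ⟨C, hC⟩).sub (ξ.integrable_tailCost g k)).neg)
    ⟨C + K, fun k ω => by
      rw [abs_neg]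
      exact (abs_sub _ _).trans (add_le_add (hC _) (hK _ _))⟩
    (fun k hk H' => by
      rw [integral_neg, integral_neg, ξ.setIntegral_stat_sub_tailCost hexch g H' ⟨C, hC⟩,
        hV.eq_qValue (hg k hk H'), sub_self, mul_zero, zero_add, mul_neg]) H
  rw [integral_neg, integral_sub (ξ.integrable_stat g t ⟨C, hC⟩).integrableOn
    (ξ.integrable_tailCost g t).integrableOn,
    setIntegral_eq_real_mul (ξ.measurableSet_infoEvent g H) (r := V (stat H))
      fun ω hω => by rw [show ξ.info g t ω = H from hω], neg_sub] at h
  exact sub_nonpos.1 h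

theorem integral_eq_sum_info (g : Strategy S n) (t : ℕ) {φ : Ω → ℝ} (hφ : Integrable φ P) :
    ∫ ω, φ ω ∂P = ∑ H : Info S n t, ∫ ω in ξ.infoEvent g H, φ ω ∂P := by
  simpa using ξ.setIntegral_eq_sum_info g t MeasurableSet.univ hφ

theorem integral_value_eq_sum (g : Strategy S n) {V : EmpDist S n × ℕ → ℝ}
    (hb : ∃ C, ∀ p, |V p| ≤ C) :
    ∫ ω, V (ξ.data 0 ω, 0) ∂P =
      ∑ H : Info S n 0, P.real (ξ.infoEvent g H) * V (stat H) := by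
  simp only [← ξ.stat_info_zero g]
  rw [ξ.integral_eq_sum_info g 0 (ξ.integrable_stat g 0 hb)]
  exact Finset.sum_congr rfl fun H _ =>
    setIntegral_eq_real_mul (ξ.measurableSet_infoEvent g H) fun ω hω => by
      rw [show ξ.info g 0 ω = H from hω]

theorem integral_value_le_J (hexch : D.Exchangeable) {V : EmpDist S n × ℕ → ℝ}
    (hb : ∃ C, ∀ p, |V p| ≤ C) (hV : D.IsBellman V) (g : Strategy S n) :
    ∫ ω, V (ξ.data 0 ω, 0) ∂P ≤ ξ.J g := by
  rw [J, ξ.integral_eq_sum_info g 0 (ξ.integrable_tailCost g 0), ξ.integral_value_eq_sum g hb]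
  exact Finset.sum_le_sum fun H _ => ξ.real_mul_le_setIntegral_tailCost hexch hb hV g H

theorem J_stationary (hexch : D.Exchangeable) {V : EmpDist S n × ℕ → ℝ}
    (hb : ∃ C, ∀ p, |V p| ≤ C) (hV : D.IsBellman V) {μ : EmpDist S n × ℕ → Bool}
    (hμ : ∀ p, D.IsGreedy V p (μ p)) :
    ξ.J (stationary μ) = ∫ ω, V (ξ.data 0 ω, 0) ∂P := by
  rw [J, ξ.integral_eq_sum_info (stationary μ) 0 (ξ.integrable_tailCost _ 0),
    ξ.integral_value_eq_sum (stationary μ) hb]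
  exact Finset.sum_congr rfl fun H _ =>
    ξ.setIntegral_tailCost_of_isGreedy hexch hb hV _ H fun _ _ _ => hμ _

end DataModel.Primitives

end

-- The theorem

theorem theorem2 {S W Ω : Type*} [Fintype S] [DecidableEq S] [Nonempty S] [MeasurableSpace S]
    [MeasurableSingletonClass S] [MeasurableSpace W] {n : ℕ} [NeZero n]
    (D : DataModel S W n) (hexch : D.Exchangeable)
    [MeasurableSpace Ω] (P : Measure Ω) [IsProbabilityMeasure P] (ξ : D.Primitives P) :
    -- `Tm` is the transition matrix of the data
    (∀ (t : ℕ) (m m' : EmpDist S n), P {ω | ξ.data t ω = m} ≠ 0 →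
      (cond P {ω | ξ.data t ω = m}).real {ω | ξ.data (t + 1) ω = m'} = D.Tm m' m) ∧
    -- the pair is a sufficient statistic, whatever the strategy is:
    (∀ g : Strategy S n,
      -- it starts at the initial data and is updated by the new observation,
      (∀ ω, stat (ξ.info g 0 ω) = (ξ.data 0 ω, 0)) ∧
      (∀ t ω, stat (ξ.info g (t + 1) ω) = fHat (stat (ξ.info g t ω)) (ξ.obs g (t + 1) ω)) ∧
      -- it determines the conditional law of the data given the information,
      (∀ (t : ℕ) (H : Info S n t), P (ξ.infoEvent g H) ≠ 0 →
        ∀ m, ξ.belief g H m = (D.Tm ^ (stat H).2) m (stat H).1) ∧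
      -- and, with the action, the conditional law of the next observation
      -- and the conditional expectation of the per-step cost
      (∀ (t : ℕ) (H : Info S n t) (a : Bool), P (ξ.infoActionEvent g H a) ≠ 0 →
        (∀ o, (cond P (ξ.infoActionEvent g H a)).real {ω | ξ.obs g (t + 1) ω = o} =
          D.obsLaw (stat H) a o) ∧
        ∫ ω, ξ.cost g t ω ∂(cond P (ξ.infoActionEvent g H a)) = D.cHat (stat H) a)) ∧
    -- the costs are well defined
    (∀ (g : Strategy S n) (t : ℕ), (∀ ω, Summable fun k : ℕ => D.γ ^ k * ξ.cost g (t + k) ω) ∧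
      Integrable (ξ.tailCost g t) P) ∧
    -- the Bellman equation has exactly one bounded solution
    (∃! V : EmpDist S n × ℕ → ℝ, (∃ C, ∀ p, |V p| ≤ C) ∧ D.IsBellman V) ∧
    -- and that solution is the optimal value and gives the optimal strategies
    (∀ V : EmpDist S n × ℕ → ℝ, (∃ C, ∀ p, |V p| ≤ C) → D.IsBellman V →
      (∀ p, 0 ≤ V p) ∧
      -- it bounds the conditional expected cost-to-go of every strategy from below,
      (∀ (g : Strategy S n) (t : ℕ) (H : Info S n t), P (ξ.infoEvent g H) ≠ 0 →
        V (stat H) ≤ ∫ ω, ξ.tailCost g t ω ∂(cond P (ξ.infoEvent g H))) ∧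
      -- with equality if the strategy uses minimizing actions from that time on,
      (∀ (g : Strategy S n) (t : ℕ) (H : Info S n t), P (ξ.infoEvent g H) ≠ 0 →
        (∀ (k : ℕ), t ≤ k → ∀ H' : Info S n k, D.IsGreedy V (stat H') (g k H')) →
        ∫ ω, ξ.tailCost g t ω ∂(cond P (ξ.infoEvent g H)) = V (stat H)) ∧
      -- every stationary strategy of minimizing actions is optimal among all strategies,
      (∀ μ : EmpDist S n × ℕ → Bool, (∀ p, D.IsGreedy V p (μ p)) →
        ∀ g : Strategy S n, ξ.J (stationary μ) ≤ ξ.J g) ∧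
      -- and the optimal performance is the expected value of `V` at the initial pair
      IsLeast (Set.range ξ.J) (∫ ω, V (ξ.data 0 ω, 0) ∂P)) := by
  have real_ne : ∀ {E : Set Ω}, P E ≠ 0 → P.real E ≠ 0 := fun h => by
    rwa [Ne, measureReal_eq_zero_iff]
  refine ⟨fun t m m' h => ξ.cond_real_data_succ hexch h m', fun g => ⟨ξ.stat_info_zero g,
    ξ.stat_info_succ g, fun t H h m => ξ.belief_eq hexch g h m, fun t H a h => ?_⟩,
    fun g t => ⟨ξ.summable_cost g t, ξ.integrable_tailCost g t⟩, D.existsUnique_isBellman,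
    fun V hb hV => ⟨hV.nonneg hb, fun g t H h => ?_, fun g t H h hg => ?_, fun μ hμ g => ?_, ?_⟩⟩
  -- The action is a function of the history, so conditioning on it as well changes nothing.
  · obtain ⟨rfl, e⟩ := ξ.infoActionEvent_eq g h
    rw [e] at h ⊢
    refine ⟨fun o => (cond_real_eq_iff (ξ.measurableSet_infoEvent g H) h _ _).2
      (ξ.real_infoEvent_inter_obs hexch g H o), ?_⟩
    rw [integral_cond_eq, ξ.setIntegral_cost hexch, inv_mul_cancel_left₀ (real_ne h)]
  · rw [integral_cond_eq, ← inv_mul_cancel_left₀ (real_ne h) (V (stat H))]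
    exact mul_le_mul_of_nonneg_left (ξ.real_mul_le_setIntegral_tailCost hexch hb hV g H)
      (inv_nonneg.2 measureReal_nonneg)
  · rw [integral_cond_eq, ξ.setIntegral_tailCost_of_isGreedy hexch hb hV g H hg,
      inv_mul_cancel_left₀ (real_ne h)]
  · rw [ξ.J_stationary hexch hb hV hμ]
    exact ξ.integral_value_le_J hexch hb hV g
  · choose μ hμ using D.exists_isGreedy V
    refine ⟨⟨stationary μ, ξ.J_stationary hexch hb hV hμ⟩, ?_⟩
    rintro _ ⟨g, rfl⟩
    exact ξ.integral_value_le_J hexch hb hV g
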